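/- Let $\mu$ be the law of a random variable $X$, let $Y$ be a square-integrable real random variable defined on the same probability space as $X$, let $F\subset L_2(\mu)$ be a nonempty, convex and compact class of functions, and let $N$ be the sample size. Write $D$ for the closed unit ball of $L_2(\mu)$, $F-F=\{f-h: f,h\in F\}$, $d_F={\rm diam}(F,L_2(\mu))$, and let $\sigma\ge 0$ be given by $\sigma^2=\inf_{f\in F}\mathbb{E}(f(X)-Y)^2$. Let $\{G_h : h\in F-F\}$ be the centred Gaussian process with covariance $\mathbb{E}\,G_hG_g=\langle h,g\rangle_{L_2(\mu)}$, where, as usual, $\mathbb{E}\sup_{h\in T}G_h$ denotes the supremum of $\mathbb{E}\max_{h\in A}G_h$ over finite nonempty $A\subset T$. Let $\mathcal{M}(F,rD)$ be the largest cardinality of a subset of $F$ that is $r$-separated in $L_2(\mu)$. For $\kappa>0$ set \begin{align*} r^*(\kappa)&=\inf\Bigl\{r>0:\ \mathbb{E}\sup_{h\in(F-F)\cap rD}G_h\le\kappa\sqrt N\,r\min\bigl\{1,\tfrac r\sigma\bigr\}\Bigr\},\\ \lambda^*(\kappa)&=\inf\Bigl\{r>0:\ \log\mathcal{M}(F,rD)\le\kappa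 N\min\bigl\{1,\tfrac{r^2}{\sigma^2}\bigr\}\Bigr\},\\ \tilde r^{\,*}(\kappa)&=\inf\Bigl\{r>0:\ \mathbb{E}\sup_{h\in(F-F)\cap rD}G_h\le\kappa\sqrt N\,\theta(r)\,r\min\bigl\{1,\tfrac r\sigma\bigr\}\Bigr\}, \end{align*} where $\theta(r)=1/\max\{1,\sqrt{\log(2d_F/r)}\}$ for $r\le 2d_F$ and $\theta(r)=1$ for $r>2d_F$. Here $\inf\emptyset=\infty$, and the minima are equal to $1$ when $\sigma=0$. There is an absolute constant $c>0$ such that, for all such $F,X,Y,N$ and every $\kappa\in(0,1)$, $$\lambda^*(\kappa)\le\tilde r^{\,*}(c\kappa).$$ Moreover, if $0<r^*(c\kappa)\le 2d_F$ and $$r^*(c\kappa)\sqrt{\log\Bigl(\frac{4d_F}{r^*(c\kappa)}\Bigr)}\le\sigma,$$ then $$\lambda^*(\kappa)\le r^*(c\kappa)\sqrt{\log\Bigl(\frac{4d_F}{r^*(c\kappa)}\Bigr)}.$$ -/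

import Mathlib

open MeasureTheory ProbabilityTheory
open scoped Pointwise RealInnerProductSpace ENNReal

noncomputable section

namespace EntropicFixedPoint

/-- `min {1, a / b}` for `a > 0`, `b ≥ 0`, where `a / 0 = ∞`, so that the value is `1` at `b = 0`. -/
def minOneDiv (a b : ℝ) : ℝ := if b = 0 then 1 else min 1 (a / b)

/-- `{G_h : h ∈ S}` is a centred Gaussian process whose covariance is given by the inner product
of the ambient Hilbert space: `𝔼 G_h G_g = ⟪h, g⟫`. -/
structure IsCanonicalGaussian {H Ω : Type*} [NormedAddCommGroup H] [InnerProductSpace ℝ H]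
    [MeasurableSpace Ω] (G : H → Ω → ℝ) (S : Set H) (P : Measure Ω) : Prop where
  isGaussianProcess : IsGaussianProcess (fun (h : S) (ω : Ω) => G (h : H) ω) P
  mean_eq_zero : ∀ h ∈ S, ∫ ω, G h ω ∂P = 0
  covariance_eq : ∀ h ∈ S, ∀ g ∈ S, ∫ ω, G h ω * G g ω ∂P = ⟪h, g⟫

/-- `𝔼 sup_{h ∈ T} G_h`, with the usual convention that it is the supremum, over the nonempty
finite subsets `A` of `T`, of `𝔼 max_{h ∈ A} G_h`. It is an extended real number. -/
def expectedSup {H Ω : Type*} [MeasurableSpace Ω] (G : H → Ω → ℝ) (P : Measure Ω)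
    (T : Set H) : EReal :=
  ⨆ (A : Finset H) (hA : A.Nonempty) (_ : (A : Set H) ⊆ T),
    ((∫ ω, A.sup' hA (fun h => G h ω) ∂P : ℝ) : EReal)

/-- `𝔼 sup_{h ∈ (F - F) ∩ r D} G_h`, where `D` is the closed unit ball. -/
def localSup {H Ω : Type*} [NormedAddCommGroup H] [MeasurableSpace Ω] (G : H → Ω → ℝ)
    (P : Measure Ω) (F : Set H) (r : ℝ) : EReal :=
  expectedSup G P ((F - F) ∩ Metric.closedBall (0 : H) r)

/-- The Gaussian fixed point `r*(κ)`. Like the fixed points below, it is an infimum in `[0, ∞]`,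
equal to `∞` when no `r` is admissible. -/
def rStar {H Ω : Type*} [NormedAddCommGroup H] [MeasurableSpace Ω] (G : H → Ω → ℝ)
    (P : Measure Ω) (F : Set H) (σ : ℝ) (N : ℕ) (κ : ℝ) : ℝ≥0∞ :=
  sInf (ENNReal.ofReal '' {r : ℝ | 0 < r ∧
    localSup G P F r ≤ ((κ * √(N : ℝ) * r * minOneDiv r σ : ℝ) : EReal)})

/-- `θ(r) = 1 / max {1, √(log (2 d / r))}`; the square root of a negative number is `0` here, so
`θ(r) = 1` for `r ≥ 2 d`. -/
def theta (d r : ℝ) : ℝ := 1 / max 1 √(Real.log (2 * d / r))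

/-- The modified Gaussian fixed point. -/
def rTildeStar {H Ω : Type*} [NormedAddCommGroup H] [MeasurableSpace Ω] (G : H → Ω → ℝ)
    (P : Measure Ω) (F : Set H) (σ : ℝ) (N : ℕ) (κ : ℝ) : ℝ≥0∞ :=
  sInf (ENNReal.ofReal '' {r : ℝ | 0 < r ∧
    localSup G P F r ≤
      ((κ * √(N : ℝ) * theta (Metric.diam F) r * r * minOneDiv r σ : ℝ) : EReal)})

/-- The logarithm of the packing number: of the largest cardinality of an `r`-separated subset
of `F`. -/
def logPacking {H : Type*} [NormedAddCommGroup H] (F : Set H) (r : ℝ) : EReal :=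
  ENNReal.log ((Metric.packingNumber r.toNNReal F : ℕ∞) : ℝ≥0∞)

/-- The entropic fixed point `λ*(κ)`. -/
def lambdaStar {H : Type*} [NormedAddCommGroup H] (F : Set H) (σ : ℝ) (N : ℕ) (κ : ℝ) : ℝ≥0∞ :=
  sInf (ENNReal.ofReal '' {r : ℝ | 0 < r ∧
    logPacking F r ≤ ((κ * (N : ℝ) * minOneDiv (r ^ 2) (σ ^ 2) : ℝ) : EReal)})

/-- The noise level `σ ≥ 0`, with `σ ^ 2 = inf_{f ∈ F} 𝔼 (f(X) - Y) ^ 2`. -/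
def noiseLevel {𝒳 Ω : Type*} [MeasurableSpace 𝒳] [MeasurableSpace Ω] {μ : Measure 𝒳}
    (P : Measure Ω) (X : Ω → 𝒳) (Y : Ω → ℝ) (F : Set (Lp ℝ 2 μ)) : ℝ :=
  √(sInf ((fun f : Lp ℝ 2 μ => ∫ ω, (f (X ω) - Y ω) ^ 2 ∂P) '' F))

end EntropicFixedPoint

end

noncomputable section

namespace EntropicFixedPoint

/-! The engine is a local dual Sudakov bound. If `𝔼 sup G ≤ B` on `(F - F) ∩ rD`, Markov gives the
event `G ≤ 4B` mass at least 3/4. Its Cameron–Martin translates by multiples of separated points are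
almost disjoint and keep mass at least `exp (-C B² / r²)`, which bounds the number of points.
Convexity shrinks an `s`-separated set in a ball of radius `2s`, for any `s ≥ r`, to scale `r`, so
one bound serves all these scales (`card_le_exp`).

Chaining over the `k ≲ log (2d / s)` dyadic scales from `s` to the diameter `d` gives `log M(F, sD)
≤ k C B² / r²` (`logPacking_le`). For the modified fixed point, `θ²` cancels `k`, so admissible
radii stay admissible. For `r*`, taking `s = r* √log(4d / r*)` multiplies `r*² / σ²` by the same
logarithm, which pays for `k`. -/

/-- Translating a centred Gaussian measure to the left by `l * v` decreases the mass of a subset of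
`(-∞, t]` by at most the factor `exp (-(l * t + l ^ 2 * v / 2))`. -/
lemma gaussianReal_shift_le {v : NNReal} (hv : v ≠ 0) {l t : ℝ} (hl : 0 ≤ l) {B : Set ℝ}
    (hB : B ⊆ Set.Iic t) :
    ENNReal.ofReal (Real.exp (-(l * t + l ^ 2 * v / 2))) * gaussianReal 0 v B ≤
      gaussianReal (-(l * v)) v B := by
  rw [gaussianReal_apply _ hv, gaussianReal_apply _ hv,
    ← lintegral_const_mul _ (measurable_gaussianPDF _ _)]
  refine setLIntegral_mono (measurable_gaussianPDF _ _) fun u hu => ?_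
  rw [gaussianPDF, gaussianPDF, ← ENNReal.ofReal_mul (Real.exp_pos _).le]
  refine ENNReal.ofReal_le_ofReal ?_
  have hv' : (0 : ℝ) < v := by positivity
  rw [gaussianPDFReal, gaussianPDFReal, mul_left_comm, ← Real.exp_add]
  refine mul_le_mul_of_nonneg_left (Real.exp_le_exp.2 ?_) (by positivity)
  have h1 : -(u - -(l * v)) ^ 2 / (2 * v) = -(l * u + l ^ 2 * v / 2) + -(u - 0) ^ 2 / (2 * v) := by
    field_simp
    ring
  rw [h1]
  -- The density ratio `exp (-(l u + l² v / 2))` decreases in `u`, so on `B` it is smallest at `t`.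
  have := mul_le_mul_of_nonneg_left (hB hu) hl
  linarith

/-! ### Shifts and packing for the canonical Gaussian process -/

variable {H Ω : Type*} [NormedAddCommGroup H] [InnerProductSpace ℝ H] [MeasurableSpace Ω]
  {G : H → Ω → ℝ} {S : Set H} {P : Measure Ω}

namespace IsCanonicalGaussian

lemma hasGaussianLaw (hG : IsCanonicalGaussian G S P) {h : H} (hh : h ∈ S) :
    HasGaussianLaw (G h) P :=
  hG.isGaussianProcess.hasGaussianLaw_eval ⟨h, hh⟩

lemma memLp_two (hG : IsCanonicalGaussian G S P) {h : H} (hh : h ∈ S) : MemLp (G h) 2 P :=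
  (hG.hasGaussianLaw hh).memLp_two

lemma covariance (hG : IsCanonicalGaussian G S P) [IsProbabilityMeasure P] {h g : H} (hh : h ∈ S)
    (hg : g ∈ S) : cov[G h, G g; P] = ⟪h, g⟫ := by
  rw [covariance_eq_sub (hG.memLp_two hh) (hG.memLp_two hg), hG.mean_eq_zero h hh]
  simpa using hG.covariance_eq h hh g hg

lemma map_eq_gaussianReal (hG : IsCanonicalGaussian G S P) [IsProbabilityMeasure P] {h : H}
    (hh : h ∈ S) : P.map (G h) = gaussianReal 0 (‖h‖₊ ^ 2) := by
  rw [(hG.hasGaussianLaw hh).map_eq_gaussianReal, hG.mean_eq_zero h hh,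
    ← covariance_self (hG.hasGaussianLaw hh).aemeasurable, hG.covariance hh hh,
    real_inner_self_eq_norm_sq]
  congr 1
  ext
  simp

/-- `G h` vanishes almost surely when `h = 0`. -/
lemma ae_zero (hG : IsCanonicalGaussian G S P) (h0 : (0 : H) ∈ S) : G 0 =ᵐ[P] 0 := by
  have h1 := hG.covariance_eq 0 h0 0 h0
  have h2 : Integrable (fun ω => G 0 ω * G 0 ω) P :=
    (hG.memLp_two h0).integrable_mul (hG.memLp_two h0)
  rw [inner_zero_left, integral_eq_zero_iff_of_nonneg (fun ω => mul_self_nonneg _) h2] at h1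
  filter_upwards [h1] with ω hω
  simpa using hω

/-- The second moment of `G h + G (-h)` is zero by the covariance formula. -/
lemma ae_neg (hG : IsCanonicalGaussian G S P) {h : H} (hh : h ∈ S) (hn : -h ∈ S) :
    G (-h) =ᵐ[P] -G h := by
  have i1 : Integrable (fun ω => G h ω * G h ω) P :=
    (hG.memLp_two hh).integrable_mul (hG.memLp_two hh)
  have i2 : Integrable (fun ω => G h ω * G (-h) ω) P :=
    (hG.memLp_two hh).integrable_mul (hG.memLp_two hn)
  have i3 : Integrable (fun ω => G (-h) ω * G (-h) ω) P :=
    (hG.memLp_two hn).integrable_mul (hG.memLp_two hn)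
  have h1 : ∫ ω, (G h ω + G (-h) ω) ^ 2 ∂P = 0 := by
    have : ∀ ω, (G h ω + G (-h) ω) ^ 2 =
        G h ω * G h ω + 2 * (G h ω * G (-h) ω) + G (-h) ω * G (-h) ω := fun ω => by ring
    simp_rw [this]
    have i4 : Integrable (fun ω => G h ω * G h ω + 2 * (G h ω * G (-h) ω)) P :=
      i1.add (i2.const_mul 2)
    rw [integral_add i4 i3, integral_add i1 (i2.const_mul 2),
      integral_const_mul, hG.covariance_eq h hh h hh, hG.covariance_eq h hh _ hn,
      hG.covariance_eq _ hn _ hn]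
    simp
    ring
  have i5 : Integrable (fun ω => (G h ω + G (-h) ω) ^ 2) P :=
    ((hG.memLp_two hh).add (hG.memLp_two hn)).integrable_sq
  rw [integral_eq_zero_iff_of_nonneg (fun ω => sq_nonneg _) i5] at h1
  filter_upwards [h1] with ω hω
  have : G h ω + G (-h) ω = 0 := by simpa using hω
  simp only [Pi.neg_apply]
  linarith

/-- The residuals of the regression of `G` on `G y` are independent of `G y`. -/
lemma indepFun_residual (hG : IsCanonicalGaussian G S P) [IsProbabilityMeasure P] {A : Finset H}
    (hA : (A : Set H) ⊆ S) {y : H} (hy : y ∈ S) (hy0 : y ≠ 0) :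
    IndepFun (G y) (fun ω (a : A) => G a ω - ⟪(a : H), y⟫ / ‖y‖ ^ 2 * G y ω) P := by
  have mR : ∀ a : A, AEMeasurable (fun ω => G a ω - ⟪(a : H), y⟫ / ‖y‖ ^ 2 * G y ω) P := fun a =>
    (hG.hasGaussianLaw (hA a.2)).aemeasurable.sub
      ((hG.hasGaussianLaw hy).aemeasurable.const_mul _)
  have key : IndepFun (fun ω (_ : Unit) => G y ω)
      (fun ω (a : A) => G a ω - ⟪(a : H), y⟫ / ‖y‖ ^ 2 * G y ω) P := by
    refine IsGaussianProcess.indepFun_of_covariance_eq_zero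
      (X := fun (_ : Unit) => G y) (Y := fun (a : A) ω => G a ω - ⟪(a : H), y⟫ / ‖y‖ ^ 2 * G y ω)
      ?_ (fun _ => (hG.hasGaussianLaw hy).aemeasurable) mR ?_
    · classical
      refine IsGaussianProcess.of_isGaussianProcess hG.isGaussianProcess ?_
      rintro (_ | a)
      · exact ⟨{⟨y, hy⟩}, .proj ⟨⟨y, hy⟩, by simp⟩, fun ω => by simp⟩
      · exact ⟨{⟨y, hy⟩, ⟨a, hA a.2⟩}, .proj ⟨⟨a, hA a.2⟩, by simp⟩ -
          (⟪(a : H), y⟫ / ‖y‖ ^ 2) • .proj ⟨⟨y, hy⟩, by simp⟩, fun ω => by simp⟩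
    · intro _ a
      have h2 : MemLp (fun ω => ⟪(a : H), y⟫ / ‖y‖ ^ 2 * G y ω) 2 P :=
        (hG.memLp_two hy).const_mul _
      have := covariance_fun_sub_right (hG.memLp_two hy) (hG.memLp_two (hA a.2)) h2
      rw [this, covariance_const_mul_right, hG.covariance hy (hA a.2), hG.covariance hy hy,
        real_inner_self_eq_norm_sq, real_inner_comm]
      have : ‖y‖ ≠ 0 := norm_ne_zero_iff.2 hy0
      field_simp
      simp
  exact key.comp (φ := fun f : Unit → ℝ => f ()) (ψ := id) (by fun_prop) measurable_id

/-- A one-sided Cameron–Martin inequality for the canonical Gaussian process. -/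
lemma shift_le (hG : IsCanonicalGaussian G S P) [IsProbabilityMeasure P] {A : Finset H}
    (hA : (A : Set H) ⊆ S) {y : H} (hy : y ∈ A) {l t : ℝ} (hl : 0 ≤ l) (ht : 0 ≤ t) :
    ENNReal.ofReal (Real.exp (-(l * t + l ^ 2 * ‖y‖ ^ 2 / 2))) * P {ω | ∀ h ∈ A, G h ω ≤ t} ≤
      P {ω | ∀ h ∈ A, G h ω - l * ⟪h, y⟫ ≤ t} := by
  rcases eq_or_ne y 0 with rfl | hy0
  · simp only [inner_zero_right, mul_zero, sub_zero]
    refine mul_le_of_le_one_left' (ENNReal.ofReal_le_one.2 (Real.exp_le_one_iff.2 ?_))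
    have : 0 ≤ l * t := mul_nonneg hl ht
    simp [this]
  have hyS := hA hy
  set c : A → ℝ := fun a => ⟪(a : H), y⟫ / ‖y‖ ^ 2 with hc
  have hn : 0 < ‖y‖ := norm_pos_iff.2 hy0
  set R : Ω → A → ℝ := fun ω a => G a ω - c a * G y ω with hR
  have mG : AEMeasurable (G y) P := (hG.hasGaussianLaw hyS).aemeasurable
  have mR : AEMeasurable R P := aemeasurable_pi_lambda _ fun a =>
    (hG.hasGaussianLaw (hA a.2)).aemeasurable.sub (mG.const_mul _)
  have hind : IndepFun (G y) R P := hG.indepFun_residual hA hyS hy0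
  have hmap : P.map (fun ω => (G y ω, R ω)) =
      (gaussianReal 0 (‖y‖₊ ^ 2)).prod (P.map R) := by
    rw [(indepFun_iff_map_prod_eq_prod_map_map mG mR).1 hind, hG.map_eq_gaussianReal hyS]
  have : IsProbabilityMeasure (P.map R) := Measure.isProbabilityMeasure_map mR
  -- Since `y ∈ A`, the condition `p.1 ≤ t` already holds on the event; it bounds each fibre above,
  -- as the one-dimensional shift estimate requires.
  set T : Set (ℝ × (A → ℝ)) := {p | (∀ a, c a * p.1 + p.2 a ≤ t) ∧ p.1 ≤ t} with hT
  have mT : MeasurableSet T := by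
    have h0 : MeasurableSet {p : ℝ × (A → ℝ) | p.1 ≤ t} :=
      measurableSet_le (by fun_prop) (by fun_prop)
    refine MeasurableSet.inter ?_ h0
    have : {p : ℝ × (A → ℝ) | ∀ a, c a * p.1 + p.2 a ≤ t} =
      ⋂ a, {p : ℝ × (A → ℝ) | c a * p.1 + p.2 a ≤ t} := by ext; simp
    show MeasurableSet {p : ℝ × (A → ℝ) | ∀ a, c a * p.1 + p.2 a ≤ t}
    rw [this]
    exact MeasurableSet.iInter fun a => measurableSet_le (by fun_prop) (by fun_prop)
  -- Moving only the `G y` coordinate by `l ‖y‖²` moves every `G h` by `l ⟪h, y⟫`, because the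
  -- residuals stay fixed.
  set T' : Set (ℝ × (A → ℝ)) := (fun p => (p.1 - l * ‖y‖ ^ 2, p.2)) ⁻¹' T with hT'
  have mT' : MeasurableSet T' := mT.preimage (by fun_prop)
  have mGR : AEMeasurable (fun ω => (G y ω, R ω)) P := mG.prodMk mR
  have e1 : {ω | ∀ h ∈ A, G h ω ≤ t} ⊆ (fun ω => (G y ω, R ω)) ⁻¹' T := fun ω hω =>
    ⟨fun a => by simpa [hR] using hω a a.2, hω y hy⟩
  have e2 : (fun ω => (G y ω, R ω)) ⁻¹' T' ⊆ {ω | ∀ h ∈ A, G h ω - l * ⟪h, y⟫ ≤ t} := by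
    intro ω hω h hh
    have h1 : c ⟨h, hh⟩ * (G y ω - l * ‖y‖ ^ 2) + R ω ⟨h, hh⟩ ≤ t := hω.1 ⟨h, hh⟩
    have h2 : c ⟨h, hh⟩ * (G y ω - l * ‖y‖ ^ 2) + R ω ⟨h, hh⟩ = G h ω - l * ⟪h, y⟫ := by
      simp only [hR, hc]
      field_simp
      ring
    rwa [h2] at h1
  refine le_trans (mul_le_mul_right (measure_mono e1) _) (le_trans ?_ (measure_mono e2))
  rw [← Measure.map_apply_of_aemeasurable mGR mT, ← Measure.map_apply_of_aemeasurable mGR mT',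
    hmap, Measure.prod_apply_symm mT, Measure.prod_apply_symm mT',
    ← lintegral_const_mul _ (measurable_measure_prodMk_right mT)]
  refine lintegral_mono fun ρ => ?_
  have h3 : gaussianReal 0 (‖y‖₊ ^ 2) ((fun u => (u, ρ)) ⁻¹' T') =
      gaussianReal (-(l * (‖y‖₊ ^ 2 : NNReal))) (‖y‖₊ ^ 2) ((fun u => (u, ρ)) ⁻¹' T) := by
    have h4 := gaussianReal_map_sub_const (μ := 0) (v := ‖y‖₊ ^ 2) (l * ‖y‖ ^ 2)
    have h5 : (-(l * (‖y‖₊ ^ 2 : NNReal)) : ℝ) = 0 - l * ‖y‖ ^ 2 := by simp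
    rw [h5, ← h4, Measure.map_apply (by fun_prop) (mT.preimage (by fun_prop))]
    rfl
  rw [h3]
  have := gaussianReal_shift_le (v := ‖y‖₊ ^ 2) (pow_ne_zero 2 (nnnorm_ne_zero_iff.2 hy0))
    (t := t) hl (B := (fun u => (u, ρ)) ⁻¹' T) (fun u hu => hu.2)
  simpa using this

/-- Dual Sudakov packing: the translates of the event `{G h ≤ t for all h ∈ A}` by the points of a
separated set are almost disjoint. -/
lemma card_mul_le_one (hG : IsCanonicalGaussian G S P) [IsProbabilityMeasure P] {A Y : Finset H}
    (hA : (A : Set H) ⊆ S) (hY : Y ⊆ A) (hsub : ∀ y ∈ Y, ∀ z ∈ Y, y - z ∈ A) {l t ρ : ℝ}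
    (hl : 0 ≤ l) (ht : 0 ≤ t) (hρ : ∀ y ∈ Y, ‖y‖ ≤ ρ)
    (hsep : ∀ y ∈ Y, ∀ z ∈ Y, y ≠ z → 2 * t < l * ‖y - z‖ ^ 2) :
    (Y.card : ℝ) * (Real.exp (-(l * t + l ^ 2 * ρ ^ 2 / 2)) *
      P.real {ω | ∀ h ∈ A, G h ω ≤ t}) ≤ 1 := by
  set E : H → Set Ω := fun y => {ω | ∀ h ∈ A, G h ω - l * ⟪h, y⟫ ≤ t} with hE
  -- On `E y ∩ E z`, add the constraints at `z - y` and `y - z`: the Gaussian terms cancel almost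
  -- surely, leaving `l ‖y - z‖² ≤ 2t`.
  have hdisj : (Y : Set H).Pairwise (Function.onFun (AEDisjoint P) E) := by
    intro y hy z hz hyz
    have hm := hsub y hy z hz
    have hm' := hsub z hz y hy
    have hneg := hG.ae_neg (hA hm) (by rw [neg_sub]; exact hA hm')
    rw [neg_sub] at hneg
    have : ∀ᵐ ω ∂P, ω ∉ E y ∩ E z := by
      filter_upwards [hneg] with ω hω hmem
      have h1 := hmem.1 _ hm'
      have h2 := hmem.2 _ hm
      have h3 := hsep y hy z hz hyz
      rw [hω, Pi.neg_apply] at h1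
      rw [← real_inner_self_eq_norm_sq, inner_sub_right] at h3
      rw [← neg_sub y z, inner_neg_left] at h1
      linarith
    exact measure_eq_zero_iff_ae_notMem.2 this
  have hnull : ∀ y ∈ Y, NullMeasurableSet (E y) P := by
    intro y _
    have : E y = ⋂ h ∈ A, {ω | G h ω - l * ⟪h, y⟫ ≤ t} := by ext; simp [hE]
    rw [this]
    refine Finset.nullMeasurableSet_biInter A fun h hh => ?_
    exact nullMeasurableSet_le ((hG.hasGaussianLaw (hA hh)).aemeasurable.sub_const _)
      aemeasurable_const
  have h1 : ∑ y ∈ Y, P (E y) ≤ 1 := by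
    rw [← measure_biUnion_finset₀ hdisj hnull]
    exact prob_le_one
  have h2 : ∑ y ∈ Y, P.real (E y) ≤ 1 := by
    have := ENNReal.toReal_mono ENNReal.one_ne_top h1
    rwa [ENNReal.toReal_sum (fun y _ => measure_ne_top _ _), ENNReal.toReal_one] at this
  refine le_trans ?_ h2
  rw [← nsmul_eq_mul]
  refine Finset.card_nsmul_le_sum _ _ _ fun y hy => ?_
  have h3 := ENNReal.toReal_mono (measure_ne_top _ _)
    (hG.shift_le hA (hY hy) hl ht)
  rw [ENNReal.toReal_mul, ENNReal.toReal_ofReal (Real.exp_pos _).le] at h3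
  refine le_trans (mul_le_mul_of_nonneg_right (Real.exp_le_exp.2 ?_) measureReal_nonneg) h3
  have := pow_le_pow_left₀ (norm_nonneg y) (hρ y hy) 2
  have := mul_le_mul_of_nonneg_left this (sq_nonneg l)
  linarith

lemma integrable_sup' (hG : IsCanonicalGaussian G S P) {A : Finset H} (hA : (A : Set H) ⊆ S)
    (hne : A.Nonempty) : Integrable (fun ω => A.sup' hne fun h => G h ω) P := by
  have : Integrable (A.sup' hne G) P :=
    Finset.sup'_induction hne G (p := fun f => Integrable f P) (fun _ h1 _ h2 => h1.sup h2)
      fun h hh => (hG.hasGaussianLaw (hA hh)).integrable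
  convert this using 1
  ext ω
  simp

/-- Markov's inequality for the supremum of the process over a finite set. -/
lemma three_quarters_le (hG : IsCanonicalGaussian G S P) [IsProbabilityMeasure P] {A : Finset H}
    (hA : (A : Set H) ⊆ S) (h0 : (0 : H) ∈ A) {B : ℝ} (hB : 0 < B)
    (hsup : ∫ ω, A.sup' ⟨0, h0⟩ (fun h => G h ω) ∂P ≤ B) :
    3 / 4 ≤ P.real {ω | ∀ h ∈ A, G h ω ≤ 4 * B} := by
  -- Because `0 ∈ A`, the maximum is almost surely nonnegative, so Markov applies.
  have hnn : 0 ≤ᵐ[P] fun ω => A.sup' ⟨0, h0⟩ (fun h => G h ω) := by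
    filter_upwards [hG.ae_zero (hA h0)] with ω hω
    have := Finset.le_sup' (fun h => G h ω) h0
    simpa [hω] using this
  have h1 := mul_meas_ge_le_integral_of_nonneg hnn (hG.integrable_sup' hA _) (4 * B)
  have h2 : (Set.univ : Set Ω) ⊆ {ω | ∀ h ∈ A, G h ω ≤ 4 * B} ∪
      {ω | 4 * B ≤ A.sup' ⟨0, h0⟩ (fun h => G h ω)} := by
    intro ω _
    rcases le_total (4 * B) (A.sup' ⟨0, h0⟩ (fun h => G h ω)) with h | h
    · exact Or.inr h
    · exact Or.inl fun g hg => (Finset.le_sup' (fun h => G h ω) hg).trans h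
  have h3 := (measureReal_mono h2 (μ := P)).trans (measureReal_union_le _ _)
  rw [probReal_univ] at h3
  have h4 : P.real {ω | 4 * B ≤ A.sup' ⟨0, h0⟩ (fun h => G h ω)} ≤ 1 / 4 := by
    by_contra! hcon
    nlinarith
  linarith

end IsCanonicalGaussian

/-! ### Local entropy and chaining -/

lemma integral_sup'_le_of_expectedSup_le {H Ω : Type*} [MeasurableSpace Ω] {G : H → Ω → ℝ}
    {P : Measure Ω} {T : Set H} {B : ℝ} (h : expectedSup G P T ≤ (B : EReal))
    {A : Finset H} (hA : (A : Set H) ⊆ T) (hne : A.Nonempty) :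
    ∫ ω, A.sup' hne (fun h => G h ω) ∂P ≤ B := by
  refine EReal.coe_le_coe_iff.1 (le_trans ?_ h)
  exact le_iSup_of_le A (le_iSup_of_le hne (le_iSup_of_le hA le_rfl))

/-- Scaling differences of points of a convex set. -/
lemma smul_sub_mem_sub {F : Set H} (hF : Convex ℝ F) {f g : H} (hf : f ∈ F) (hg : g ∈ F) {τ : ℝ}
    (h0 : 0 ≤ τ) (h1 : τ ≤ 1) : τ • (f - g) ∈ F - F := by
  refine Set.mem_sub.2 ⟨τ • f + (1 - τ) • g, hF hf hg h0 (by linarith) (by ring), g, hg, ?_⟩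
  module

/-- Local Sudakov bound, with an unspecified prefactor. -/
lemma card_le_exp_local {F : Set H} (hG : IsCanonicalGaussian G (F - F) P) [IsProbabilityMeasure P]
    (hF : Convex ℝ F) {r s B : ℝ} (hr : 0 < r) (hrs : r ≤ s) (hB : 0 < B)
    (hloc : localSup G P F r ≤ (B : EReal)) {f₀ : H} (hf₀ : f₀ ∈ F) {Z : Finset H}
    (hZ : (Z : Set H) ⊆ F) (hball : ∀ f ∈ Z, ‖f - f₀‖ ≤ 2 * s)
    (hsep : ∀ f ∈ Z, ∀ g ∈ Z, f ≠ g → s < ‖f - g‖) :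
    (Z.card : ℝ) ≤ 4 / 3 * Real.exp (2560 * B ^ 2 / r ^ 2) := by
  classical
  have hs : 0 < s := hr.trans_le hrs
  -- The factor 4 sends radius `2s` to `r / 2`, so that differences stay in `rD`, and separation `s`
  -- to `r / 4`.
  set τ : ℝ := r / (4 * s) with hτ
  have hτ0 : 0 < τ := by positivity
  have hτ1 : τ ≤ 1 := (div_le_one (by positivity)).2 (by linarith)
  have hτs : τ * s = r / 4 := by rw [hτ]; field_simp
  set Y : Finset H := Z.image fun f => τ • (f - f₀) with hY
  have hcard : Y.card = Z.card := Finset.card_image_of_injective _ fun f g hfg => by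
    simpa [hτ0.ne'] using hfg
  -- Zero serves Markov, `Y` the shifts, and `Y - Y` the disjointness of the translates.
  set A : Finset H := insert 0 (Y ∪ (Y - Y)) with hA
  have hYmem : ∀ y ∈ Y, ∃ f ∈ Z, y = τ • (f - f₀) := fun y hy => by
    obtain ⟨f, hf, rfl⟩ := Finset.mem_image.1 hy
    exact ⟨f, hf, rfl⟩
  have hYY : ∀ f g : H, τ • (f - f₀) - τ • (g - f₀) = τ • (f - g) := fun f g => by module
  have hnorm : ∀ y ∈ Y, ‖y‖ ≤ r / 2 := fun y hy => by
    obtain ⟨f, hf, rfl⟩ := hYmem y hy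
    rw [norm_smul, Real.norm_of_nonneg hτ0.le]
    have := mul_le_mul_of_nonneg_left (hball f hf) hτ0.le
    linarith
  have hAT : (A : Set H) ⊆ (F - F) ∩ Metric.closedBall 0 r := by
    intro h hh
    rw [hA, Finset.mem_coe, Finset.mem_insert, Finset.mem_union] at hh
    rcases hh with rfl | hh | hh
    · exact ⟨⟨f₀, hf₀, f₀, hf₀, sub_self _⟩, by simpa using hr.le⟩
    · refine ⟨?_, by simpa using (hnorm h hh).trans (by linarith)⟩
      obtain ⟨f, hf, rfl⟩ := hYmem h hh
      exact smul_sub_mem_sub hF (hZ hf) hf₀ hτ0.le hτ1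
    · obtain ⟨y, hy, z, hz, rfl⟩ := Finset.mem_sub.1 hh
      constructor
      · obtain ⟨f, hf, rfl⟩ := hYmem y hy
        obtain ⟨g, hg, rfl⟩ := hYmem z hz
        rw [hYY]
        exact smul_sub_mem_sub hF (hZ hf) (hZ hg) hτ0.le hτ1
      · have := norm_sub_le y z
        have := hnorm y hy
        have := hnorm z hz
        rw [mem_closedBall_zero_iff]
        linarith
  have hAS : (A : Set H) ⊆ F - F := hAT.trans Set.inter_subset_left
  have h0A : (0 : H) ∈ A := Finset.mem_insert_self _ _
  have hmk := hG.three_quarters_le hAS h0A hB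
    (integral_sup'_le_of_expectedSup_le hloc hAT ⟨0, h0A⟩)
  -- `l` solves `l (r / 4)² = 2t` with `t = 4B`.
  have hpack := hG.card_mul_le_one hAS (Y := Y) (l := 128 * B / r ^ 2) (t := 4 * B) (ρ := r / 2)
    (fun y hy => by simp [hA, hy])
    (fun y hy z hz => by
      rw [hA, Finset.mem_insert, Finset.mem_union]
      exact Or.inr (Or.inr (Finset.sub_mem_sub hy hz)))
    (by positivity) (by positivity) hnorm
    (fun y hy z hz hyz => by
      obtain ⟨f, hf, rfl⟩ := hYmem y hy
      obtain ⟨g, hg, rfl⟩ := hYmem z hz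
      have hfg : f ≠ g := fun h => hyz (by rw [h])
      have h1 := mul_lt_mul_of_pos_left (hsep f hf g hg hfg) hτ0
      rw [hYY, norm_smul, Real.norm_of_nonneg hτ0.le]
      rw [hτs] at h1
      have h2 := pow_lt_pow_left₀ h1 (by positivity) two_ne_zero
      have h3 := mul_lt_mul_of_pos_left h2 (show 0 < 128 * B / r ^ 2 by positivity)
      have h4 : 128 * B / r ^ 2 * (r / 4) ^ 2 = 2 * (4 * B) := by
        field_simp
        norm_num
      linarith)
  have hexp : -(128 * B / r ^ 2 * (4 * B) + (128 * B / r ^ 2) ^ 2 * (r / 2) ^ 2 / 2) =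
      -(2560 * B ^ 2 / r ^ 2) := by
    field_simp
    norm_num
  rw [hcard, hexp, Real.exp_neg] at hpack
  set e := Real.exp (2560 * B ^ 2 / r ^ 2) with he
  have he0 : 0 < e := Real.exp_pos _
  have h5 : (Z.card : ℝ) * (e⁻¹ * (3 / 4)) ≤ 1 :=
    (mul_le_mul_of_nonneg_left (mul_le_mul_of_nonneg_left hmk (by positivity))
      (by positivity)).trans hpack
  have h6 : (Z.card : ℝ) * (e⁻¹ * (3 / 4)) = Z.card * (3 / 4) / e := by ring
  rw [h6, div_le_one he0] at h5
  linarith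

/-- Local Sudakov bound: the cardinality of an `s`-separated subset of `F` inside a ball of radius
`2 * s` is controlled by the local Gaussian supremum at any smaller scale `r`. -/
lemma card_le_exp {F : Set H} (hG : IsCanonicalGaussian G (F - F) P) [IsProbabilityMeasure P]
    (hF : Convex ℝ F) {r s B : ℝ} (hr : 0 < r) (hrs : r ≤ s) (hB : 0 ≤ B)
    (hloc : localSup G P F r ≤ (B : EReal)) {f₀ : H} (hf₀ : f₀ ∈ F) {Z : Finset H}
    (hZ : (Z : Set H) ⊆ F) (hball : ∀ f ∈ Z, ‖f - f₀‖ ≤ 2 * s)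
    (hsep : ∀ f ∈ Z, ∀ g ∈ Z, f ≠ g → s < ‖f - g‖) :
    (Z.card : ℝ) ≤ Real.exp (8192 * B ^ 2 / r ^ 2) := by
  -- Letting `b ↓ B` covers `B = 0`, where Markov's threshold degenerates.
  have hlim : (Z.card : ℝ) ≤ 4 / 3 * Real.exp (2560 * B ^ 2 / r ^ 2) := by
    have hcont : Filter.Tendsto (fun b : ℝ => 4 / 3 * Real.exp (2560 * b ^ 2 / r ^ 2))
        (nhdsWithin B (Set.Ioi B)) (nhds (4 / 3 * Real.exp (2560 * B ^ 2 / r ^ 2))) :=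
      (Continuous.tendsto (by fun_prop) B).mono_left nhdsWithin_le_nhds
    refine ge_of_tendsto hcont ?_
    filter_upwards [self_mem_nhdsWithin] with b hb
    exact card_le_exp_local hG hF hr hrs (hB.trans_lt hb)
      (hloc.trans (EReal.coe_le_coe_iff.2 (le_of_lt hb))) hf₀ hZ hball hsep
  set q := B ^ 2 / r ^ 2 with hq
  have hq0 : 0 ≤ q := by positivity
  rw [mul_div_assoc, ← hq] at hlim ⊢
  rcases Nat.lt_or_ge Z.card 2 with h2 | h2
  · have : (Z.card : ℝ) ≤ 1 := by exact_mod_cast Nat.lt_succ_iff.1 h2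
    exact this.trans (Real.one_le_exp (by positivity))
  · have h2' : (2 : ℝ) ≤ Z.card := by exact_mod_cast h2
    -- With at least two points the exponential is at least 3/2, so a second copy of it absorbs the
    -- prefactor.
    have h3 : 4 / 3 ≤ Real.exp (2560 * q) := by linarith
    calc (Z.card : ℝ) ≤ 4 / 3 * Real.exp (2560 * q) := hlim
      _ ≤ Real.exp (2560 * q) * Real.exp (2560 * q) :=
          mul_le_mul_of_nonneg_right h3 (Real.exp_pos _).le
      _ = Real.exp (5120 * q) := by rw [← Real.exp_add]; ring_nf
      _ ≤ Real.exp (8192 * q) := Real.exp_le_exp.2 (by linarith)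

/-- Chaining over dyadic scales: a local packing bound `L` at every scale at least `s` gives the
packing bound `L ^ k` at scale `s`, where `2 ^ k * s` exceeds the diameter. -/
lemma card_le_pow_of_local {H : Type*} [NormedAddCommGroup H] {F : Set H} {L : ℝ} (hL : 1 ≤ L)
    {d r : ℝ}
    (hd : ∀ f ∈ F, ∀ g ∈ F, ‖f - g‖ ≤ d)
    (hloc : ∀ s, r ≤ s → ∀ f₀ ∈ F, ∀ Z : Finset H, (Z : Set H) ⊆ F →
      (∀ f ∈ Z, ‖f - f₀‖ ≤ 2 * s) → (∀ f ∈ Z, ∀ g ∈ Z, f ≠ g → s < ‖f - g‖) → (Z.card : ℝ) ≤ L)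
    (k : ℕ) {s : ℝ} (hs : 0 < s) (hrs : r ≤ s) (hk : d ≤ 2 ^ k * s) {Z : Finset H}
    (hZ : (Z : Set H) ⊆ F) (hsep : ∀ f ∈ Z, ∀ g ∈ Z, f ≠ g → s < ‖f - g‖) :
    (Z.card : ℝ) ≤ L ^ k := by
  classical
  induction k generalizing s Z with
  | zero =>
    have : Z.card ≤ 1 := Finset.card_le_one.2 fun f hf g hg => by
      by_contra hfg
      have h1 := hsep f hf g hg hfg
      have h2 := hd f (hZ hf) g (hZ hg)
      simp only [pow_zero, one_mul] at hk
      linarith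
    simpa using this
  | succ k ih =>
    -- A maximal `2s`-separated `W ⊆ Z` is a `2s`-net of `Z`: induction bounds `W`, the local bound
    -- each ball.
    let p : Finset H → Prop := fun W => W ⊆ Z ∧ ∀ f ∈ W, ∀ g ∈ W, f ≠ g → 2 * s < ‖f - g‖
    obtain ⟨W, hW⟩ : ∃ W, Maximal p W := by
      have hfin : {W | p W}.Finite := Z.powerset.finite_toSet.subset fun W hW => by
        simpa using hW.1
      exact hfin.exists_maximal ⟨∅, by simp [p]⟩
    have hcover : ∀ f ∈ Z, ∃ g ∈ W, ‖f - g‖ ≤ 2 * s := by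
      intro f hf
      by_contra! hcon
      have hp : p (insert f W) := by
        refine ⟨Finset.insert_subset hf hW.prop.1, fun a ha b hb hab => ?_⟩
        rcases Finset.mem_insert.1 ha with rfl | ha' <;>
          rcases Finset.mem_insert.1 hb with rfl | hb'
        · exact absurd rfl hab
        · exact hcon b hb'
        · rw [norm_sub_rev]; exact hcon a ha'
        · exact hW.prop.2 a ha' b hb' hab
      have hfW : f ∈ W := hW.le_of_ge hp (Finset.subset_insert f W) (Finset.mem_insert_self f W)
      have := hcon f hfW
      rw [sub_self, norm_zero] at this
      linarith
    have hWZ : (W : Set H) ⊆ F := fun f hf => hZ (hW.prop.1 hf)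
    have hWcard : (W.card : ℝ) ≤ L ^ k := ih (s := 2 * s) (by linarith) (by linarith)
      (by rw [pow_succ] at hk; linarith) hWZ hW.prop.2
    have hsubset : Z ⊆ W.biUnion fun g => Z.filter fun f => ‖f - g‖ ≤ 2 * s := fun f hf => by
      obtain ⟨g, hg, hfg⟩ := hcover f hf
      exact Finset.mem_biUnion.2 ⟨g, hg, Finset.mem_filter.2 ⟨hf, hfg⟩⟩
    have h1 : (Z.card : ℝ) ≤ ∑ g ∈ W, ((Z.filter fun f => ‖f - g‖ ≤ 2 * s).card : ℝ) := by
      exact_mod_cast (Finset.card_le_card hsubset).trans Finset.card_biUnion_le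
    have h2 : ∑ g ∈ W, ((Z.filter fun f => ‖f - g‖ ≤ 2 * s).card : ℝ) ≤ W.card • L :=
      Finset.sum_le_card_nsmul _ _ _ fun g hg => hloc s hrs g (hWZ hg) _
        (fun f hf => hZ (Finset.mem_filter.1 hf).1) (fun f hf => (Finset.mem_filter.1 hf).2)
        fun f hf h hh => hsep f (Finset.mem_filter.1 hf).1 h (Finset.mem_filter.1 hh).1
    rw [nsmul_eq_mul] at h2
    have h3 := mul_le_mul_of_nonneg_right hWcard (zero_le_one.trans hL)
    rw [pow_succ]
    linarith

/-- A larger separated set, even an infinite one, would contain a finite one with exactly `⌊exp x⌋₊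
+ 1` points. -/
lemma logPacking_le_of_card_le {H : Type*} [NormedAddCommGroup H] {F : Set H} {r x : ℝ}
    (hr : 0 ≤ r)
    (h : ∀ Z : Finset H, (Z : Set H) ⊆ F → (∀ f ∈ Z, ∀ g ∈ Z, f ≠ g → r < ‖f - g‖) →
      (Z.card : ℝ) ≤ Real.exp x) : logPacking F r ≤ (x : EReal) := by
  have hfl : Metric.packingNumber r.toNNReal F ≤ ((⌊Real.exp x⌋₊ : ℕ) : ℕ∞) := by
    refine iSup_le fun C => iSup_le fun hC => iSup_le fun hsep => ?_
    by_contra! hcon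
    obtain ⟨D, hDC, hD⟩ := Set.exists_subset_encard_eq (Order.add_one_le_of_lt hcon)
    have hDfin : D.Finite := Set.finite_of_encard_eq_coe (k := ⌊Real.exp x⌋₊ + 1) (by simpa using hD)
    have hcard := h hDfin.toFinset (by simpa using hDC.trans hC) fun f hf g hg hfg => by
      have h1 : ENNReal.ofReal r < edist f g :=
        hsep (hDC (by simpa using hf)) (hDC (by simpa using hg)) hfg
      rw [edist_dist, dist_eq_norm] at h1
      exact (ENNReal.ofReal_lt_ofReal_iff_of_nonneg hr).1 h1
    have h2 := Nat.le_floor hcard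
    rw [hDfin.encard_eq_coe_toFinset_card] at hD
    have h3 : hDfin.toFinset.card = ⌊Real.exp x⌋₊ + 1 := by exact_mod_cast hD
    omega
  have h1 : ((Metric.packingNumber r.toNNReal F : ℕ∞) : ℝ≥0∞) ≤ ENNReal.ofReal (Real.exp x) := by
    refine (ENat.toENNReal_le.2 hfl).trans ?_
    rw [ENat.toENNReal_coe, ← ENNReal.ofReal_natCast]
    exact ENNReal.ofReal_le_ofReal (Nat.floor_le (Real.exp_pos x).le)
  refine (ENNReal.log_le_log h1).trans ?_
  rw [ENNReal.log_ofReal_of_pos (Real.exp_pos x), Real.log_exp]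

/-- The entropy of `F` at scale `s` in terms of the local Gaussian supremum at a scale `r ≤ s`. -/
lemma logPacking_le {F : Set H} (hG : IsCanonicalGaussian G (F - F) P) [IsProbabilityMeasure P]
    (hF : Convex ℝ F) (hb : Bornology.IsBounded F) {r s B : ℝ} (hr : 0 < r) (hrs : r ≤ s)
    (hB : 0 ≤ B) (hloc : localSup G P F r ≤ (B : EReal)) {k : ℕ}
    (hk : Metric.diam F ≤ 2 ^ k * s) :
    logPacking F s ≤ ((k * (8192 * B ^ 2 / r ^ 2) : ℝ) : EReal) := by
  refine logPacking_le_of_card_le (hr.le.trans hrs) fun Z hZ hsep => ?_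
  rw [Real.exp_nat_mul]
  refine card_le_pow_of_local (Real.one_le_exp (by positivity)) (d := Metric.diam F) (r := r)
    (fun f hf g hg => ?_) (fun s hrs f₀ hf₀ Z hZ hball hsep =>
      card_le_exp hG hF hr hrs hB hloc hf₀ hZ hball hsep) k (hr.trans_le hrs) hrs hk hZ hsep
  rw [← dist_eq_norm]
  exact Metric.dist_le_diam_of_mem hb hf hg

lemma logPacking_nonpos_of_diam_le {H : Type*} [NormedAddCommGroup H] {F : Set H}
    (hb : Bornology.IsBounded F) {s : ℝ} (hs : 0 ≤ s) (hd : Metric.diam F ≤ s) : logPacking F s ≤ 0 := by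
  refine logPacking_le_of_card_le (x := 0) hs fun Z hZ hsep => ?_
  rw [Real.exp_zero]
  have : Z.card ≤ 1 := Finset.card_le_one.2 fun f hf g hg => by
    by_contra hfg
    have h1 := hsep f hf g hg hfg
    rw [← dist_eq_norm] at h1
    have h2 := Metric.dist_le_diam_of_mem hb (hZ hf) (hZ hg)
    linarith
  exact_mod_cast this

/-! ### Comparison of the fixed points -/

lemma minOneDiv_nonneg {a b : ℝ} (ha : 0 ≤ a) (hb : 0 ≤ b) : 0 ≤ minOneDiv a b := by
  unfold minOneDiv
  split_ifs
  · exact zero_le_one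
  · exact le_min zero_le_one (by positivity)

lemma minOneDiv_le_div {a b : ℝ} (hb : b ≠ 0) : minOneDiv a b ≤ a / b := by
  rw [minOneDiv, if_neg hb]
  exact min_le_right _ _

lemma minOneDiv_sq {a b : ℝ} (ha : 0 ≤ a) (hb : 0 ≤ b) :
    minOneDiv a b ^ 2 = minOneDiv (a ^ 2) (b ^ 2) := by
  unfold minOneDiv
  rcases eq_or_ne b 0 with rfl | hb0
  · simp
  rw [if_neg hb0, if_neg (pow_ne_zero 2 hb0), ← div_pow]
  have h : 0 ≤ a / b := by positivity
  rcases le_total (a / b) 1 with h1 | h1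
  · rw [min_eq_right h1, min_eq_right (pow_le_one₀ h h1)]
  · rw [min_eq_left h1, min_eq_left (one_le_pow₀ h1), one_pow]

/-- The number of dyadic scales between `s` and `d`. -/
lemma exists_dyadic {d s : ℝ} (hs : 0 < s) (hsd : s < d) :
    ∃ k : ℕ, d ≤ 2 ^ k * s ∧ (k : ℝ) ≤ 2 * Real.log (2 * d / s) := by
  have hd : 0 < d := hs.trans hsd
  have hq : 1 < d / s := (one_lt_div hs).2 hsd
  -- `log 2 > 1/2` turns the `+ 1` from the ceiling into at most `2 log 2`.
  have hlog2 : 1 / 2 < Real.log 2 := by linarith [Real.log_two_gt_d9]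
  have hlq : 0 < Real.log (d / s) := Real.log_pos hq
  refine ⟨⌈Real.log (d / s) / Real.log 2⌉₊, ?_, ?_⟩
  · rw [← div_le_iff₀ hs, ← Real.log_le_log_iff (by positivity) (by positivity), Real.log_pow]
    exact (div_le_iff₀ (by positivity)).1 (Nat.le_ceil _)
  · have h1 := Nat.ceil_lt_add_one (a := Real.log (d / s) / Real.log 2) (by positivity)
    have h2 : Real.log (2 * d / s) = Real.log 2 + Real.log (d / s) := by
      rw [mul_div_assoc, Real.log_mul (by norm_num) (by positivity)]
    have h3 : Real.log (d / s) / Real.log 2 ≤ 2 * Real.log (d / s) := by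
      rw [div_le_iff₀ (by positivity)]
      nlinarith
    linarith

lemma theta_nonneg (d r : ℝ) : 0 ≤ theta d r := by
  unfold theta
  positivity

lemma log_mul_theta_sq_le_one (d r : ℝ) : Real.log (2 * d / r) * theta d r ^ 2 ≤ 1 := by
  have h1 : 1 ≤ max 1 √(Real.log (2 * d / r)) := le_max_left _ _
  rw [theta, div_pow, one_pow, mul_one_div, div_le_one (by positivity)]
  rcases le_total (Real.log (2 * d / r)) 0 with h | h
  · exact h.trans (by positivity)
  · calc Real.log (2 * d / r) = √(Real.log (2 * d / r)) ^ 2 := (Real.sq_sqrt h).symm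
      _ ≤ _ := pow_le_pow_left₀ (Real.sqrt_nonneg _) (le_max_right _ _) 2

/-- An admissible radius for the modified Gaussian fixed point is admissible for the entropic
fixed point. -/
lemma logPacking_le_of_localSup_le_theta {F : Set H} (hG : IsCanonicalGaussian G (F - F) P)
    [IsProbabilityMeasure P] (hF : Convex ℝ F) (hb : Bornology.IsBounded F) {σ : ℝ} (hσ : 0 ≤ σ)
    {N : ℕ} {κ : ℝ} (hκ0 : 0 < κ) (hκ1 : κ < 1) {r : ℝ} (hr : 0 < r)
    (h : localSup G P F r ≤
      ((1 / 256 * κ * √(N : ℝ) * theta (Metric.diam F) r * r * minOneDiv r σ : ℝ) : EReal)) :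
    logPacking F r ≤ ((κ * (N : ℝ) * minOneDiv (r ^ 2) (σ ^ 2) : ℝ) : EReal) := by
  have hm := minOneDiv_nonneg hr.le hσ
  have hθ := theta_nonneg (Metric.diam F) r
  rcases le_or_gt (Metric.diam F) r with hd | hd
  · refine (logPacking_nonpos_of_diam_le hb hr.le hd).trans (EReal.coe_nonneg.2 ?_)
    have := minOneDiv_nonneg (sq_nonneg r) (sq_nonneg σ)
    positivity
  obtain ⟨k, hk, hk'⟩ := exists_dyadic hr hd
  refine (logPacking_le hG hF hb hr le_rfl (by positivity) h hk).trans (EReal.coe_le_coe_iff.2 ?_)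
  rw [← minOneDiv_sq hr.le hσ]
  set m := minOneDiv r σ
  set θ := theta (Metric.diam F) r with hθ'
  have h1 : (k : ℝ) * θ ^ 2 ≤ 2 := by
    have := log_mul_theta_sq_le_one (Metric.diam F) r
    have := mul_le_mul_of_nonneg_right hk' (sq_nonneg θ)
    linarith
  have hN : √(N : ℝ) ^ 2 = N := Real.sq_sqrt (Nat.cast_nonneg N)
  have h2 : (k : ℝ) * (8192 * (1 / 256 * κ * √(N : ℝ) * θ * r * m) ^ 2 / r ^ 2) =
      1 / 8 * (k * θ ^ 2) * (κ * (κ * N * m ^ 2)) := by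
    simp only [mul_pow, hN]
    field_simp
    ring
  rw [h2]
  have h3 : 0 ≤ κ * N * m ^ 2 := by positivity
  -- The squared Gaussian bound carries `κ²`; `κ < 1` reduces it to `κ`.
  have h4 : κ * (κ * N * m ^ 2) ≤ κ * N * m ^ 2 := mul_le_of_le_one_left h3 hκ1.le
  have h5 : 0 ≤ κ * (κ * N * m ^ 2) := by positivity
  nlinarith

lemma lambdaStar_le_rTildeStar {F : Set H} (hG : IsCanonicalGaussian G (F - F) P)
    [IsProbabilityMeasure P] (hF : Convex ℝ F) (hb : Bornology.IsBounded F) {σ : ℝ} (hσ : 0 ≤ σ)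
    {N : ℕ} {κ : ℝ} (hκ0 : 0 < κ) (hκ1 : κ < 1) :
    lambdaStar F σ N κ ≤ rTildeStar G P F σ N (1 / 256 * κ) :=
  sInf_le_sInf <| Set.image_mono fun _ hr =>
    ⟨hr.1, logPacking_le_of_localSup_le_theta hG hF hb hσ hκ0 hκ1 hr.1 hr.2⟩

lemma lambdaStar_le_of_rStar_eq {F : Set H} (hG : IsCanonicalGaussian G (F - F) P)
    [IsProbabilityMeasure P] (hF : Convex ℝ F) (hb : Bornology.IsBounded F) {σ : ℝ}
    {N : ℕ} {κ : ℝ} (hκ0 : 0 < κ) (hκ1 : κ < 1) {ρ : ℝ} (hρ : 0 < ρ)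
    (hstar : rStar G P F σ N (1 / 256 * κ) = ENNReal.ofReal ρ) (hρd : ρ ≤ 2 * Metric.diam F)
    (hρσ : ρ * √(Real.log (4 * Metric.diam F / ρ)) ≤ σ) :
    lambdaStar F σ N κ ≤ ENNReal.ofReal (ρ * √(Real.log (4 * Metric.diam F / ρ))) := by
  set d := Metric.diam F
  set ℓ := Real.log (4 * d / ρ) with hℓ
  have hd0 : 0 < d := by linarith
  have hℓ2 : Real.log 2 ≤ ℓ := by
    refine Real.log_le_log two_pos ?_
    rw [le_div_iff₀ hρ]
    linarith
  have hlog2 := Real.log_two_gt_d9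
  have hℓ0 : 0 < ℓ := by linarith
  set s := ρ * √ℓ with hs
  have hsq : √ℓ ^ 2 = ℓ := Real.sq_sqrt hℓ0.le
  have hs0 : 0 < s := by positivity
  have hσ0 : 0 < σ := hs0.trans_le hρσ
  refine sInf_le ⟨s, ⟨hs0, ?_⟩, rfl⟩
  rcases le_or_gt d s with hds | hds
  · refine (logPacking_nonpos_of_diam_le hb hs0.le hds).trans (EReal.coe_nonneg.2 ?_)
    have := minOneDiv_nonneg (sq_nonneg s) (sq_nonneg σ)
    positivity
  -- `s < d` forces `d > 4ρ/5`, hence `4d / ρ > 16/5 > e`. This makes `ρ < s`, leaving room for an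
  -- admissible `r ≤ s`.
  have hℓ1 : 1 < ℓ := by
    have h1 : 4 / 5 ≤ √ℓ := Real.le_sqrt_of_sq_le (by linarith)
    have h2 : ρ * (4 / 5) ≤ s := mul_le_mul_of_nonneg_left h1 hρ.le
    rw [hℓ, Real.lt_log_iff_exp_lt (by positivity), lt_div_iff₀ hρ]
    have := Real.exp_one_lt_d9
    nlinarith
  have hρs : ρ < s := by
    have : 1 < √ℓ := Real.lt_sqrt_of_sq_lt (by linarith)
    exact lt_mul_of_one_lt_right hρ this
  -- The infimum need not be attained, so an admissible radius within a factor 2 of it is used.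
  obtain ⟨r, ⟨hr0, hr⟩, hrs, hr2⟩ : ∃ r : ℝ, (0 < r ∧ localSup G P F r ≤
      ((1 / 256 * κ * √(N : ℝ) * r * minOneDiv r σ : ℝ) : EReal)) ∧ r ≤ s ∧ r ≤ 2 * ρ := by
    have h1 : rStar G P F σ N (1 / 256 * κ) < ENNReal.ofReal (min s (2 * ρ)) := by
      rw [hstar]
      exact (ENNReal.ofReal_lt_ofReal_iff (by positivity)).2 (lt_min hρs (by linarith))
    obtain ⟨_, ⟨r, hr, rfl⟩, hlt⟩ := sInf_lt_iff.1 h1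
    have h2 := ((ENNReal.ofReal_lt_ofReal_iff (by positivity)).1 hlt).le
    exact ⟨r, hr, h2.trans (min_le_left _ _), h2.trans (min_le_right _ _)⟩
  obtain ⟨k, hk, hk'⟩ := exists_dyadic hs0 hds
  have hm := minOneDiv_nonneg hr0.le hσ0.le
  refine (logPacking_le hG hF hb hr0 hrs (by positivity) hr hk).trans (EReal.coe_le_coe_iff.2 ?_)
  have hkℓ : (k : ℝ) ≤ 2 * ℓ := by
    refine hk'.trans (mul_le_mul_of_nonneg_left (Real.log_le_log (by positivity) ?_) two_pos.le)
    exact div_le_div₀ (by positivity) (by linarith) hρ hρs.le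
  have hmσ : minOneDiv r σ ≤ 2 * ρ / σ :=
    (minOneDiv_le_div hσ0.ne').trans (div_le_div_of_nonneg_right hr2 hσ0.le)
  -- The hypothesis `s ≤ σ` selects the quadratic branch of the minimum.
  have hmin : minOneDiv (s ^ 2) (σ ^ 2) = ρ ^ 2 * ℓ / σ ^ 2 := by
    rw [minOneDiv, if_neg (by positivity), min_eq_right]
    · rw [hs, mul_pow, hsq]
    · exact (div_le_one (by positivity)).2 (pow_le_pow_left₀ hs0.le hρσ 2)
  rw [hmin]
  set m := minOneDiv r σ
  have hm2 : m ^ 2 ≤ 4 * (ρ ^ 2 / σ ^ 2) := by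
    refine (pow_le_pow_left₀ hm hmσ 2).trans (le_of_eq ?_)
    ring
  have hN : √(N : ℝ) ^ 2 = N := Real.sq_sqrt (Nat.cast_nonneg N)
  have h2 : (k : ℝ) * (8192 * (1 / 256 * κ * √(N : ℝ) * r * m) ^ 2 / r ^ 2) =
      1 / 8 * (κ * (κ * N)) * (k * m ^ 2) := by
    simp only [mul_pow, hN]
    field_simp
    ring
  rw [h2]
  have h3 : (k : ℝ) * m ^ 2 ≤ 2 * ℓ * (4 * (ρ ^ 2 / σ ^ 2)) :=
    mul_le_mul hkℓ hm2 (sq_nonneg m) (by positivity)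
  have h4 : κ * (κ * N) ≤ κ * N := mul_le_of_le_one_left (by positivity) hκ1.le
  calc 1 / 8 * (κ * (κ * N)) * (k * m ^ 2)
      ≤ 1 / 8 * (κ * N) * (2 * ℓ * (4 * (ρ ^ 2 / σ ^ 2))) := by gcongr
    _ = κ * N * (ρ ^ 2 * ℓ / σ ^ 2) := by ring

end EntropicFixedPoint

end

theorem mainTheorem11 :
    ∃ c : ℝ, 0 < c ∧
      ∀ {𝒳 Ω Ω' : Type*} [MeasurableSpace 𝒳] [MeasurableSpace Ω] [MeasurableSpace Ω']
        (μ : Measure 𝒳) [IsProbabilityMeasure μ]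
        (P : Measure Ω) [IsProbabilityMeasure P]
        (P' : Measure Ω') [IsProbabilityMeasure P']
        (X : Ω → 𝒳) (_ : HasLaw X μ P)
        (Y : Ω → ℝ) (_ : MemLp Y 2 P)
        (F : Set (Lp ℝ 2 μ)) (_ : F.Nonempty) (_ : Convex ℝ F) (_ : IsCompact F)
        (G : Lp ℝ 2 μ → Ω' → ℝ)
        (_ : EntropicFixedPoint.IsCanonicalGaussian G (F - F) P')
        (N : ℕ) (κ : ℝ) (_ : 0 < κ) (_ : κ < 1),
        EntropicFixedPoint.lambdaStar F (EntropicFixedPoint.noiseLevel P X Y F) N κ ≤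
            EntropicFixedPoint.rTildeStar G P' F
              (EntropicFixedPoint.noiseLevel P X Y F) N (c * κ) ∧
        ∀ ρ : ℝ, 0 < ρ →
          EntropicFixedPoint.rStar G P' F (EntropicFixedPoint.noiseLevel P X Y F) N (c * κ) =
            ENNReal.ofReal ρ →
          ρ ≤ 2 * Metric.diam F →
          ρ * √(Real.log (4 * Metric.diam F / ρ)) ≤ EntropicFixedPoint.noiseLevel P X Y F →
          EntropicFixedPoint.lambdaStar F (EntropicFixedPoint.noiseLevel P X Y F) N κ ≤
            ENNReal.ofReal (ρ * √(Real.log (4 * Metric.diam F / ρ))) := by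
  -- `8192 / 256² = 1/8` exactly offsets, in the second claim, the 2 from counting scales and the 4
  -- from `r ≤ 2ρ`.
  refine ⟨1 / 256, by norm_num, ?_⟩
  intro 𝒳 Ω Ω' _ _ _ μ _ P _ P' _ X _ Y _ F _ hF hFc G hG N κ hκ0 hκ1
  exact ⟨EntropicFixedPoint.lambdaStar_le_rTildeStar hG hF hFc.isBounded (Real.sqrt_nonneg _)
    hκ0 hκ1, fun ρ hρ hstar hρd hρσ =>
      EntropicFixedPoint.lambdaStar_le_of_rStar_eq hG hF hFc.isBounded hκ0 hκ1 hρ hstar hρd hρσ⟩
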